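/- For $n\in\mathbb N$ let $A_n$ be the finite integral symmetric relation algebra with atoms $1', r, b_1,\dots,b_n$ in which a diversity cycle $xyz$ (a triple of atoms different from $1'$) is mandatory, i.e. $x;y\ge z$, if it involves $r$, and forbidden, i.e. $x;y\cdot z=0$, otherwise; $A_2$ is the relation algebra $32_{65}$. A representation of a relation algebra $A$ over a set $U$ is an embedding of $A$ into the algebra of all subsets of $U\times U$ under union, complement, relational composition, relational inverse and the identity relation. Let $\operatorname{spec}(A)$ be the set of cardinals $\alpha\le\omega$ such that $A$ has a representation over a set of cardinality $\alpha$, and put $f(n)=\min(\operatorname{spec}(A_n))$. Then $$26\le f(2)\le 1024$$ (in particular no representation of $32_{65}$ has fewer than $26$ points), and: 1. $f(n)\ge 2n^2+4n+1$ for all $n$; 2. $f(n)\le 2n^{6+o(1)}$ as $n\to\infty$; that is, there is a sequence $\varepsilon(n)\to 0$ such that, for all sufficiently large $n$, $f(n)$ is finite and $f(n)\le 2n^{6+\varepsilon(n)}$. -/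

import Mathlib

/-- Relation algebras: Boolean algebras with an involuted monoid structure `(comp, conv, ident)`,
both operations additive, satisfying the Peircean law. -/
class RelationAlgebra (A : Type*) extends BooleanAlgebra A where
  /-- relative multiplication `x ; y` -/
  comp : A → A → A
  /-- converse -/
  conv : A → A
  /-- the identity element `1'` -/
  ident : A
  comp_assoc : ∀ x y z, comp (comp x y) z = comp x (comp y z)
  comp_ident : ∀ x, comp x ident = x
  ident_comp : ∀ x, comp ident x = x
  conv_conv : ∀ x, conv (conv x) = x
  conv_comp : ∀ x y, conv (comp x y) = comp (conv y) (conv x)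
  comp_sup : ∀ x y z, comp x (y ⊔ z) = comp x y ⊔ comp x z
  conv_sup : ∀ x y, conv (x ⊔ y) = conv x ⊔ conv y
  peirce : ∀ x y z, comp x y ⊓ conv z = ⊥ ↔ comp y z ⊓ conv x = ⊥

namespace RelationAlgebra

/-- A (square) representation of `A` over the set `U`: an embedding of `A` into the algebra of all
binary relations on `U`, i.e. subsets of `U × U`, with union, complement in `U × U`, relational
composition, relational inverse and the identity relation. -/
structure Representation (A : Type*) [RelationAlgebra A] (U : Type*) where
  toFun : A → SetRel U U
  injective : Function.Injective toFun
  map_sup : ∀ x y, toFun (x ⊔ y) = toFun x ∪ toFun y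
  map_compl : ∀ x, toFun xᶜ = (toFun x)ᶜ
  map_comp : ∀ x y, toFun (comp x y) = (toFun x).comp (toFun y)
  map_conv : ∀ x, toFun (conv x) = (toFun x).inv
  map_ident : toFun ident = SetRel.id

/-- The spectrum: the set of all cardinals `α ≤ ω` such that `A` has a representation over a set
of cardinality `α`. -/
def spec (A : Type*) [RelationAlgebra A] : Set Cardinal.{0} :=
  {α | α ≤ Cardinal.aleph0 ∧ ∃ U : Type, Cardinal.mk U = α ∧ Nonempty (Representation A U)}

/-- The atoms `1'`, `r`, `b₁, …, bₙ` of the algebra `Aₙ`. -/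
inductive SplitAtom (n : ℕ) : Type
  | ident : SplitAtom n
  | red : SplitAtom n
  | blue (i : Fin n) : SplitAtom n

/-- `SplitAtom.Cycle x y z` says that the atom `z` lies below `x ; y` in `Aₙ`. If one of the three
is `1'` this is forced by the identity law and symmetry; a diversity cycle is mandatory if and only
if it involves `r`. -/
def SplitAtom.Cycle {n : ℕ} : SplitAtom n → SplitAtom n → SplitAtom n → Prop
  | .ident, y, z => y = z
  | x, .ident, z => x = z
  | x, y, .ident => x = y
  | x, y, z => x = .red ∨ y = .red ∨ z = .red

theorem SplitAtom.cycle_assoc {n : ℕ} (x y z w : SplitAtom n) :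
    (∃ u, SplitAtom.Cycle x y u ∧ SplitAtom.Cycle u z w) ↔
      ∃ v, SplitAtom.Cycle y z v ∧ SplitAtom.Cycle x v w := by
  constructor
  · rintro ⟨u, h1, h2⟩
    by_cases hd : x = .ident ∨ y = .ident ∨ z = .ident ∨ w = .ident
    · rcases hd with rfl | rfl | rfl | rfl
      · exact ⟨w, by cases y <;> cases z <;> cases u <;> cases w <;> simp_all [Cycle],
          by cases w <;> simp [Cycle]⟩
      · exact ⟨z, by cases z <;> simp [Cycle],
          by cases x <;> cases z <;> cases u <;> cases w <;> simp_all [Cycle]⟩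
      · exact ⟨y, by cases y <;> simp [Cycle],
          by cases x <;> cases y <;> cases u <;> cases w <;> simp_all [Cycle]⟩
      · exact ⟨x, by cases x <;> cases y <;> cases u <;> cases z <;> simp_all [Cycle],
          by cases x <;> simp [Cycle]⟩
    · exact ⟨.red, by cases y <;> cases z <;> simp_all [Cycle],
        by cases x <;> cases w <;> simp_all [Cycle]⟩
  · rintro ⟨u, h1, h2⟩
    by_cases hd : x = .ident ∨ y = .ident ∨ z = .ident ∨ w = .ident
    · rcases hd with rfl | rfl | rfl | rfl
      · exact ⟨y, by cases y <;> simp [Cycle],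
          by cases y <;> cases z <;> cases u <;> cases w <;> simp_all [Cycle]⟩
      · exact ⟨x, by cases x <;> simp [Cycle],
          by cases x <;> cases z <;> cases u <;> cases w <;> simp_all [Cycle]⟩
      · exact ⟨w, by cases x <;> cases y <;> cases u <;> cases w <;> simp_all [Cycle],
          by cases w <;> simp [Cycle]⟩
      · exact ⟨z, by cases x <;> cases y <;> cases u <;> cases z <;> simp_all [Cycle],
          by cases z <;> simp [Cycle]⟩
    · exact ⟨.red, by cases x <;> cases y <;> simp_all [Cycle],
        by cases z <;> cases w <;> simp_all [Cycle]⟩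

theorem SplitAtom.cycle_swap {n : ℕ} (x y z : SplitAtom n) : Cycle x y z ↔ Cycle y x z := by
  cases x <;> cases y <;> cases z <;> simp [Cycle, eq_comm]

theorem SplitAtom.cycle_rotate {n : ℕ} (x y z : SplitAtom n) : Cycle x y z ↔ Cycle y z x := by
  cases x <;> cases y <;> cases z <;> simp [Cycle, eq_comm]

/-- The set of all atoms below products of members of two sets of atoms. -/
def SplitAtom.comp {n : ℕ} (X Y : Set (SplitAtom n)) : Set (SplitAtom n) :=
  {z | ∃ x ∈ X, ∃ y ∈ Y, SplitAtom.Cycle x y z}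

/-- The finite relation algebra `Aₙ`: its elements are the sets of atoms. -/
def SplitAlgebra (n : ℕ) : Type := Set (SplitAtom n)

noncomputable instance SplitAlgebra.instBooleanAlgebra (n : ℕ) : BooleanAlgebra (SplitAlgebra n) :=
  inferInstanceAs (BooleanAlgebra (Set (SplitAtom n)))

/-- In `Aₙ` every element is its own converse (the algebra is symmetric), and `1'` is an atom. -/
noncomputable instance SplitAlgebra.instRelationAlgebra (n : ℕ) : RelationAlgebra (SplitAlgebra n) where
  comp X Y := SplitAtom.comp X Y
  conv X := X
  ident := ({SplitAtom.ident} : Set (SplitAtom n))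
  comp_assoc X Y Z := by
    refine Set.ext fun w => ⟨?_, ?_⟩
    · rintro ⟨u, ⟨x, hx, y, hy, h1⟩, z, hz, h2⟩
      obtain ⟨v, h3, h4⟩ := (SplitAtom.cycle_assoc x y z w).1 ⟨u, h1, h2⟩
      exact ⟨x, hx, v, ⟨y, hy, z, hz, h3⟩, h4⟩
    · rintro ⟨x, hx, v, ⟨y, hy, z, hz, h3⟩, h4⟩
      obtain ⟨u, h1, h2⟩ := (SplitAtom.cycle_assoc x y z w).2 ⟨v, h3, h4⟩
      exact ⟨u, ⟨x, hx, y, hy, h1⟩, z, hz, h2⟩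
  comp_ident X := by
    refine Set.ext fun w => ⟨?_, fun hw => ⟨w, hw, .ident, rfl, ?_⟩⟩
    · rintro ⟨x, hx, y, rfl, h⟩
      have : x = w := by cases x <;> simpa [SplitAtom.Cycle] using h
      exact this ▸ hx
    · cases w <;> simp [SplitAtom.Cycle]
  ident_comp X := by
    refine Set.ext fun w => ⟨?_, fun hw => ⟨.ident, rfl, w, hw, ?_⟩⟩
    · rintro ⟨x, rfl, y, hy, h⟩
      have : y = w := by simpa [SplitAtom.Cycle] using h
      exact this ▸ hy
    · simp [SplitAtom.Cycle]
  conv_conv X := rfl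
  conv_comp X Y := by
    refine Set.ext fun w => ⟨?_, ?_⟩
    · rintro ⟨x, hx, y, hy, h⟩
      exact ⟨y, hy, x, hx, (SplitAtom.cycle_swap x y w).1 h⟩
    · rintro ⟨x, hx, y, hy, h⟩
      exact ⟨y, hy, x, hx, (SplitAtom.cycle_swap x y w).1 h⟩
  comp_sup X Y Z := by
    refine Set.ext fun w => ⟨?_, ?_⟩
    · rintro ⟨x, hx, y, hy | hy, h⟩
      · exact Or.inl ⟨x, hx, y, hy, h⟩
      · exact Or.inr ⟨x, hx, y, hy, h⟩
    · rintro (⟨x, hx, y, hy, h⟩ | ⟨x, hx, y, hy, h⟩)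
      · exact ⟨x, hx, y, Or.inl hy, h⟩
      · exact ⟨x, hx, y, Or.inr hy, h⟩
  conv_sup X Y := rfl
  peirce X Y Z := by
    refine Set.eq_empty_iff_forall_notMem.trans
      (Iff.trans ?_ Set.eq_empty_iff_forall_notMem.symm)
    constructor
    · rintro H x ⟨⟨y, hy, z, hz, h⟩, hx⟩
      exact H z ⟨⟨x, hx, y, hy, (SplitAtom.cycle_rotate x y z).2 h⟩, hz⟩
    · rintro H z ⟨⟨x, hx, y, hy, h⟩, hz⟩
      exact H x ⟨⟨y, hy, z, hz, (SplitAtom.cycle_rotate x y z).1 h⟩, hx⟩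

/-- `f n = min (spec Aₙ)`. (Cardinals are well-ordered, so a nonempty set of cardinals contains its
infimum; the infimum of the empty set would be `0`.) -/
noncomputable def f (n : ℕ) : Cardinal.{0} := sInf (spec (SplitAlgebra n))

end RelationAlgebra

/-! ### Representations as edge colourings -/

namespace RelationAlgebra

open SplitAtom

/-! A representation of `SplitAlgebra n` amounts to a colouring of a complete graph by red and `n`
blues with no all-blue triangle, in which every edge has a witness for each cycle the algebra allows
on it (`IsSplitColoring`).

Lower bounds. A point red to `v` sees all `n` blues inside each blue colour class around `v`. Two
such points joined by a blue edge see disjoint parts of the class, and one of them can be made to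
see a colour twice; so each class has at least `2n + 1` points (`two_mul_add_one_le_card_blue`) and
each blue degree is at least `n(2n + 1)`. The ends of a blue edge have disjoint blue neighbourhoods,
and some point lies in neither (`le_card`). For `n = 2`, adding up degrees over a blue pentagon
gives `26`.

Upper bounds. In the Boolean group of subsets of `3k + 1` points, the sets with at least `2k + 1`
elements form a sum-free set; these are blue. The sum of two complements is the sum of the sets
themselves, so all witnesses come from a colouring of the sets of size at most `k` in which every
nonempty set of size at most `2k` is a sum with prescribed colours (`IsRichColoring`). A union bound
gives such a colouring once `k ≥ 18` and `n² ≤ 2^(k+1)`. With `k = ⌊log₂ n²⌋` the group has at most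
`2n⁶` elements, so `ε = 0` serves. An explicit colouring for `n = 2`, `k = 3` gives `2^10 = 1024`.
-/

theorem SplitAtom.finite (n : ℕ) : Finite (SplitAtom n) := by
  refine Finite.of_injective
    (fun a : SplitAtom n => match a with
      | .ident => (none : Option (Option (Fin n)))
      | .red => some none
      | .blue i => some (some i)) ?_
  intro a b h
  cases a <;> cases b <;> simp_all

/-- A labelling of the pairs of points of `U` by atoms of `Aₙ` in which a triangle of labels occurs,
and occurs on every suitably labelled edge, exactly if it is a cycle of `Aₙ`. -/
structure IsSplitColoring {n : ℕ} {U : Type*} (col : U → U → SplitAtom n) : Prop where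
  eq_ident_iff : ∀ u v, col u v = .ident ↔ u = v
  symm : ∀ u v, col u v = col v u
  surj : ∀ a, ∃ u v, col u v = a
  cycle : ∀ u v w, Cycle (col u v) (col v w) (col u w)
  witness : ∀ u w a b, Cycle a b (col u w) → ∃ v, col u v = a ∧ col v w = b

theorem IsSplitColoring.nonempty_representation {n : ℕ} {U : Type*} {col : U → U → SplitAtom n}
    (h : IsSplitColoring col) : Nonempty (Representation (SplitAlgebra n) U) := by
  refine ⟨⟨fun X => {p | col p.1 p.2 ∈ (show Set (SplitAtom n) from X)}, ?_, ?_, ?_, ?_, ?_, ?_⟩⟩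
  · intro X Y hXY
    refine Set.ext fun a => ?_
    obtain ⟨u, v, rfl⟩ := h.surj a
    exact Set.ext_iff.1 hXY (u, v)
  · intro X Y; rfl
  · intro X; rfl
  · intro X Y
    ext ⟨u, w⟩
    constructor
    · rintro ⟨a, ha, b, hb, hab⟩
      obtain ⟨v, rfl, rfl⟩ := h.witness u w a b hab
      exact ⟨v, ha, hb⟩
    · rintro ⟨v, h1, h2⟩
      exact ⟨_, h1, _, h2, h.cycle u v w⟩
  · intro X
    ext ⟨u, v⟩
    change col u v ∈ (show Set (SplitAtom n) from X) ↔ col v u ∈ (show Set (SplitAtom n) from X)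
    rw [h.symm]
  · ext ⟨u, v⟩
    exact h.eq_ident_iff u v

theorem Representation.map_bot {A U : Type*} [RelationAlgebra A] (ρ : Representation A U) :
    ρ.toFun ⊥ = ∅ := by
  have h1 := ρ.map_compl ⊤
  have h2 := ρ.map_sup ⊤ ⊥
  rw [compl_top] at h1
  rw [sup_bot_eq] at h2
  rw [Set.eq_empty_iff_forall_notMem]
  intro x hx
  have h3 : x ∈ ρ.toFun ⊤ := by rw [h2]; exact Or.inr hx
  rw [h1] at hx
  exact hx h3

/-- A representation is only required to preserve binary joins; since there are finitely many atoms,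
this is enough to split an element into atoms. -/
theorem Representation.exists_mem_atom {n : ℕ} {U : Type*}
    (ρ : Representation (SplitAlgebra n) U) (X : Set (SplitAtom n)) (p : U × U)
    (hp : p ∈ ρ.toFun X) : ∃ a ∈ X, p ∈ ρ.toFun ({a} : Set (SplitAtom n)) := by
  have := SplitAtom.finite n
  induction X, X.toFinite using Set.Finite.induction_on with
  | empty => exact absurd hp (by rw [show ρ.toFun (∅ : Set (SplitAtom n)) = ∅ from ρ.map_bot]; simp)
  | @insert a s _ _ ih =>
    have h : ρ.toFun (insert a s : Set (SplitAtom n)) = ρ.toFun ({a} : Set (SplitAtom n)) ∪ ρ.toFun s :=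
      ρ.map_sup ({a} : Set (SplitAtom n)) s
    rw [h] at hp
    rcases hp with hp | hp
    · exact ⟨a, Or.inl rfl, hp⟩
    · obtain ⟨b, hb, hb'⟩ := ih hp
      exact ⟨b, Or.inr hb, hb'⟩

theorem Representation.mono {A U : Type*} [RelationAlgebra A] (ρ : Representation A U) {x y : A}
    (h : x ≤ y) : ρ.toFun x ⊆ ρ.toFun y := by
  have := ρ.map_sup x y
  rw [sup_eq_right.2 h] at this
  rw [this]
  exact Set.subset_union_left

theorem Representation.exists_isSplitColoring {n : ℕ} {U : Type*}
    (ρ : Representation (SplitAlgebra n) U) :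
    ∃ col : U → U → SplitAtom n, IsSplitColoring col := by
  have htop : ∀ p, ∃ a, p ∈ ρ.toFun ({a} : Set (SplitAtom n)) := fun p => by
    by_cases hp : p ∈ ρ.toFun ({SplitAtom.ident} : Set (SplitAtom n))
    · exact ⟨_, hp⟩
    · obtain ⟨a, -, ha⟩ := ρ.exists_mem_atom _ p
        ((Set.ext_iff.1 (ρ.map_compl ({SplitAtom.ident} : Set (SplitAtom n))) p).2 hp)
      exact ⟨a, ha⟩
  choose col hcol using htop
  have huniq : ∀ p a, p ∈ ρ.toFun ({a} : Set (SplitAtom n)) → col p = a := by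
    intro p a ha
    by_contra hne
    -- Distinct atoms have disjoint images: one lies below the complement of the other.
    refine (Set.ext_iff.1 (ρ.map_compl ({col p} : Set (SplitAtom n))) p).1 ?_ (hcol p)
    refine ρ.mono (x := ({a} : Set (SplitAtom n))) ?_ ha
    exact show ({a} : Set (SplitAtom n)) ⊆ ({col p} : Set (SplitAtom n))ᶜ from
      fun b hb hb' => hne (hb'.symm.trans hb)
  have hiff : ∀ p a, p ∈ ρ.toFun ({a} : Set (SplitAtom n)) ↔ col p = a :=
    fun p a => ⟨huniq p a, fun h => h ▸ hcol p⟩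
  have hcomp : ∀ a b : SplitAtom n, comp (A := SplitAlgebra n) ({a} : Set (SplitAtom n))
      ({b} : Set (SplitAtom n)) = {z : SplitAtom n | Cycle a b z} := by
    intro a b
    refine Set.ext fun z => ⟨?_, fun h => ⟨a, rfl, b, rfl, h⟩⟩
    rintro ⟨_, rfl, _, rfl, h⟩
    exact h
  refine ⟨fun u v => col (u, v), ?_, ?_, ?_, ?_, ?_⟩
  · intro u v
    rw [← hiff, show ρ.toFun ({SplitAtom.ident} : Set (SplitAtom n)) = SetRel.id from ρ.map_ident]
    rfl
  · intro u v
    refine huniq _ _ ?_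
    have := ρ.map_conv ({col (v, u)} : Set (SplitAtom n))
    change ρ.toFun ({col (v, u)} : Set (SplitAtom n)) = _ at this
    rw [this]
    exact hcol (v, u)
  · intro a
    have hne : ρ.toFun ({a} : Set (SplitAtom n)) ≠ ∅ := fun h =>
      Set.singleton_ne_empty a (ρ.injective (h.trans ρ.map_bot.symm))
    obtain ⟨⟨u, v⟩, huv⟩ := Set.nonempty_iff_ne_empty.2 hne
    exact ⟨u, v, huniq _ _ huv⟩
  · intro u v w
    have h := ρ.map_comp ({col (u, v)} : Set (SplitAtom n)) ({col (v, w)} : Set (SplitAtom n))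
    rw [hcomp] at h
    have hm : (u, w) ∈ ρ.toFun {z : SplitAtom n | Cycle (col (u, v)) (col (v, w)) z} := by
      rw [h]; exact ⟨v, hcol _, hcol _⟩
    obtain ⟨z, hz, hz'⟩ := ρ.exists_mem_atom _ _ hm
    rw [huniq _ _ hz']
    exact hz
  · intro u w a b hab
    have h := ρ.map_comp ({a} : Set (SplitAtom n)) ({b} : Set (SplitAtom n))
    rw [hcomp] at h
    have hm : (u, w) ∈ ρ.toFun {z : SplitAtom n | Cycle a b z} :=
      ρ.mono (x := ({col (u, w)} : Set (SplitAtom n)))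
        (show ({col (u, w)} : Set (SplitAtom n)) ⊆ {z | Cycle a b z} by rintro _ rfl; exact hab)
        (hcol _)
    rw [h] at hm
    obtain ⟨v, h1, h2⟩ := hm
    exact ⟨v, huniq _ _ h1, huniq _ _ h2⟩

end RelationAlgebra

/-! ### Lower bounds from blue degrees -/

namespace RelationAlgebra

/-- The atoms `b₁, …, bₙ`. -/
def SplitAtom.IsBlue {n : ℕ} (a : SplitAtom n) : Prop := ∃ i, a = .blue i

namespace IsSplitColoring

open SplitAtom

variable {n : ℕ} {U : Type*} {col : U → U → SplitAtom n}

theorem not_isBlue (h : IsSplitColoring col) {u v w : U} (h1 : (col u v).IsBlue)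
    (h2 : (col v w).IsBlue) : ¬ (col u w).IsBlue := by
  rintro ⟨k, hk⟩
  obtain ⟨i, hi⟩ := h1
  obtain ⟨j, hj⟩ := h2
  have := h.cycle u v w
  simp [hi, hj, hk, SplitAtom.Cycle] at this

theorem eq_red (h : IsSplitColoring col) {u v w : U} (h1 : (col u v).IsBlue)
    (h2 : (col v w).IsBlue) (hne : u ≠ w) : col u w = .red := by
  have h3 := h.not_isBlue h1 h2
  rcases hc : col u w with _ | _ | i
  · exact absurd ((h.eq_ident_iff _ _).1 hc) hne
  · rfl
  · exact absurd ⟨i, hc⟩ h3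

theorem isBlue_comm (h : IsSplitColoring col) {u v : U} (h1 : (col u v).IsBlue) :
    (col v u).IsBlue := h.symm u v ▸ h1

theorem exists_blue_blue (h : IsSplitColoring col) {u v : U} (huv : col u v = .red) (i j : Fin n) :
    ∃ w, col u w = .blue i ∧ col w v = .blue j :=
  h.witness u v _ _ (by simp [huv, SplitAtom.Cycle])

theorem exists_red_blue (h : IsSplitColoring col) {u v : U} (huv : col u v = .red) (i : Fin n) :
    ∃ w, col u w = .red ∧ col w v = .blue i :=
  h.witness u v _ _ (by simp [huv, SplitAtom.Cycle])

theorem exists_blue_red (h : IsSplitColoring col) {u v : U} (huv : col u v = .red) (i : Fin n) :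
    ∃ w, col u w = .blue i ∧ col w v = .red :=
  h.witness u v _ _ (by simp [huv, SplitAtom.Cycle])

theorem exists_red_red (h : IsSplitColoring col) {u v : U} (huv : u ≠ v) :
    ∃ w, col u w = .red ∧ col w v = .red := by
  refine h.witness u v _ _ ?_
  rcases hc : col u v with _ | _ | i
  · exact absurd ((h.eq_ident_iff _ _).1 hc) huv
  · simp [SplitAtom.Cycle]
  · simp [SplitAtom.Cycle]

theorem exists_eq (h : IsSplitColoring col) (u : U) (a : SplitAtom n) : ∃ v, col u v = a := by
  obtain ⟨v, hv, -⟩ := h.witness u u a a (by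
    rw [(h.eq_ident_iff u u).2 rfl]; cases a <;> simp [SplitAtom.Cycle])
  exact ⟨v, hv⟩

theorem le_card_of_forall_blue {u : U} {T : Finset U} (hT : ∀ j, ∃ w ∈ T, col u w = .blue j) :
    n ≤ T.card := by
  choose w hw hw' using hT
  simpa using Finset.card_le_card_of_injOn (s := Finset.univ) w (fun j _ => hw j)
    (fun i _ j _ hij => by
      have h1 := hw' i
      have h2 := hw' j
      simp only [hij] at h1
      simpa using h1.symm.trans h2)

variable [Fintype U]

-- For `n ≥ 2`, take `w`, `w'` in the class `S` and a point `u ≠ v` joined to both in one blue `j ≠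
-- i`, then `u'` red to `v` and blue to `u`. The blue neighbours of `u` and of `u'` in `S` are
-- disjoint, at least `n + 1` and `n` in number.
open Classical in
theorem two_mul_add_one_le_card_blue (h : IsSplitColoring col) (v : U) (i : Fin n) :
    2 * n + 1 ≤ (Finset.univ.filter fun w => col v w = .blue i).card := by
  set S := Finset.univ.filter fun w => col v w = .blue i with hS
  have hmem : ∀ w, w ∈ S ↔ col v w = .blue i := fun w => by simp [hS]
  have hex : ∀ u, col v u = .red → ∀ j, ∃ w ∈ S, col u w = .blue j := by
    intro u hu j
    obtain ⟨w, h1, h2⟩ := h.exists_blue_blue hu i j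
    exact ⟨w, (hmem w).2 h1, by rw [h.symm, h2]⟩
  obtain ⟨x, hx⟩ := h.exists_eq v .red
  obtain ⟨w, hw, hwx⟩ := h.exists_blue_blue hx i i
  obtain ⟨w', hw', hwx'⟩ := h.exists_blue_red hx i
  have hne : w ≠ w' := by
    rintro rfl
    simp [hwx] at hwx'
  have hvw : (col w v).IsBlue := h.isBlue_comm ⟨i, hw⟩
  have hww : col w w' = .red := h.eq_red hvw ⟨i, hw'⟩ hne
  by_cases hn : ∃ j, j ≠ i
  · obtain ⟨j, hj⟩ := hn
    obtain ⟨u, hu, hu'⟩ := h.exists_blue_blue hww j j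
    have hvu : col v u = .red := by
      refine h.eq_red ⟨i, hw⟩ ⟨j, hu⟩ ?_
      rintro rfl
      rw [h.symm, hw] at hu
      exact hj (by simpa using hu.symm)
    obtain ⟨u', hvu', huu'⟩ := h.exists_red_blue hvu i
    set P := S.filter fun w => (col u w).IsBlue with hP
    set Q := S.filter fun w => (col u' w).IsBlue with hQ
    have hQn : n ≤ Q.card := by
      refine le_card_of_forall_blue (col := col) (u := u') fun k => ?_
      obtain ⟨y, hy, hy'⟩ := hex u' hvu' k
      exact ⟨y, Finset.mem_filter.2 ⟨hy, k, hy'⟩, hy'⟩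
    -- `w` already supplies colour `j` for `u`, so `w'` can be removed and `n` colours remain: this
    -- is the extra point.
    have hw'P : w' ∈ P := Finset.mem_filter.2 ⟨(hmem _).2 hw', j, hu'⟩
    have hPn : n ≤ (P.erase w').card := by
      refine le_card_of_forall_blue (col := col) (u := u) fun k => ?_
      by_cases hk : k = j
      · subst hk
        have huw : col u w = .blue k := by rw [h.symm, hu]
        exact ⟨w, Finset.mem_erase.2 ⟨hne, Finset.mem_filter.2 ⟨(hmem _).2 hw, k, huw⟩⟩, huw⟩
      · obtain ⟨y, hy, hy'⟩ := hex u hvu k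
        refine ⟨y, Finset.mem_erase.2 ⟨?_, Finset.mem_filter.2 ⟨hy, k, hy'⟩⟩, hy'⟩
        rintro rfl
        exact hk (by simpa [hu'] using hy'.symm)
    have hdisj : Disjoint P Q := by
      rw [Finset.disjoint_left]
      intro y hy hy'
      exact h.not_isBlue (Finset.mem_filter.1 hy').2 (h.isBlue_comm (Finset.mem_filter.1 hy).2)
        ⟨i, huu'⟩
    have hsub : P ∪ Q ⊆ S :=
      Finset.union_subset (Finset.filter_subset _ _) (Finset.filter_subset _ _)
    have h1 := Finset.card_le_card hsub
    rw [Finset.card_union_of_disjoint hdisj] at h1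
    have h2 := Finset.card_erase_add_one hw'P
    omega
  · push Not at hn
    have hn1 : n = 1 := by
      have : Subsingleton (Fin n) := ⟨fun a b => (hn a).trans (hn b).symm⟩
      have h1 := Fintype.card_le_one_iff_subsingleton.2 this
      rw [Fintype.card_fin] at h1
      have := i.pos
      omega
    -- With one blue colour a third point of `S` suffices. If `u` is not itself in `S`, it is red to
    -- `v` and has a blue neighbour in `S`, which cannot be `w` or `w'`.
    obtain ⟨u, hu, hu'⟩ := h.exists_red_red hne
    obtain ⟨y, hyS, hyw, hyw'⟩ : ∃ y ∈ S, y ≠ w ∧ y ≠ w' := by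
      rcases hc : col v u with _ | _ | k
      · rw [(h.eq_ident_iff _ _).1 hc] at hvw
        simp [hu, IsBlue] at hvw
      · obtain ⟨y, hy, hy'⟩ := hex u hc i
        refine ⟨y, hy, ?_, ?_⟩ <;> rintro rfl
        · rw [h.symm, hu] at hy'
          simp at hy'
        · simp [hu'] at hy'
      · refine ⟨u, (hmem u).2 (by rw [hc, hn k]), ?_, ?_⟩ <;> rintro rfl
        · simp [(h.eq_ident_iff _ _).2] at hu
        · simp [(h.eq_ident_iff _ _).2] at hu'
    have h1 : ({w, w', y} : Finset U) ⊆ S := by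
      intro t ht
      simp only [Finset.mem_insert, Finset.mem_singleton] at ht
      rcases ht with rfl | rfl | rfl
      · exact (hmem _).2 hw
      · exact (hmem _).2 hw'
      · exact hyS
    have h2 := Finset.card_le_card h1
    rw [Finset.card_eq_three.2 ⟨w, w', y, hne, hyw.symm, hyw'.symm, rfl⟩] at h2
    omega

open Classical in
theorem le_card_isBlue (h : IsSplitColoring col) (v : U) :
    n * (2 * n + 1) ≤ (Finset.univ.filter fun w => (col v w).IsBlue).card := by
  have h1 : (Finset.univ.filter fun w => (col v w).IsBlue) =
      Finset.univ.biUnion fun i => Finset.univ.filter fun w => col v w = .blue i := by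
    ext w
    simp only [Finset.mem_filter, Finset.mem_univ, true_and, Finset.mem_biUnion]
    rfl
  rw [h1, Finset.card_biUnion]
  · simpa using Finset.sum_le_sum
      (fun (i : Fin n) (_ : i ∈ Finset.univ) => h.two_mul_add_one_le_card_blue v i)
  · intro i _ j _ hij
    rw [Function.onFun, Finset.disjoint_left]
    intro w hw hw'
    simp only [Finset.mem_filter, Finset.mem_univ, true_and] at hw hw'
    exact hij (by simpa using hw.symm.trans hw')

open Classical in
theorem le_card (h : IsSplitColoring col) (hn : 0 < n) :
    2 * (n * (2 * n + 1)) + 1 ≤ Fintype.card U := by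
  obtain ⟨v, -, -⟩ := h.surj .ident
  obtain ⟨w, hw⟩ := h.exists_eq v (.blue ⟨0, hn⟩)
  have hvw : (col v w).IsBlue := ⟨_, hw⟩
  obtain ⟨z, hz, hz'⟩ := h.exists_red_red (u := v) (v := w) (by
    rintro rfl
    simp [(h.eq_ident_iff _ _).2] at hw)
  have hd : Disjoint (Finset.univ.filter fun t => (col v t).IsBlue)
      (Finset.univ.filter fun t => (col w t).IsBlue) := by
    rw [Finset.disjoint_left]
    intro t ht ht'
    simp only [Finset.mem_filter, Finset.mem_univ, true_and] at ht ht'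
    exact h.not_isBlue hvw ht' ht
  have hlt : (Finset.univ.filter fun t => (col v t).IsBlue) ∪
      (Finset.univ.filter fun t => (col w t).IsBlue) ⊂ Finset.univ := by
    refine Finset.ssubset_univ_iff.2 fun he => ?_
    have := he ▸ Finset.mem_univ z
    rw [h.symm] at hz'
    simp only [Finset.mem_union, Finset.mem_filter, Finset.mem_univ, true_and, hz, hz'] at this
    simp [IsBlue] at this
  have h1 := Finset.card_lt_card hlt
  rw [Finset.card_union_of_disjoint hd, Finset.card_univ] at h1
  have h2 := h.le_card_isBlue v
  have h3 := h.le_card_isBlue w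
  omega

end IsSplitColoring

/-! ### The pentagon argument for two blue colours -/

open SplitAtom in
open Classical in
/-- Each point has at most two blue neighbours on a blue pentagon. If all blue degrees are at least
`10`, this excludes fewer than `26` points. -/
theorem IsSplitColoring.twentySix_le_card {U : Type*} [Fintype U] {col : U → U → SplitAtom 2}
    (h : IsSplitColoring col) : 26 ≤ Fintype.card U := by
  obtain ⟨v, -, -⟩ := h.surj .ident
  obtain ⟨w, hw⟩ := h.exists_eq v (.blue 0)
  have hvw : (col v w).IsBlue := ⟨_, hw⟩
  obtain ⟨z, hvz, hzw⟩ := h.exists_red_red (u := v) (v := w) (by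
    rintro rfl
    simp [(h.eq_ident_iff _ _).2] at hw)
  -- The pentagon is `v`, `w`, `y`, `z`, `x` in cyclic order.
  obtain ⟨x, hvx, hxz⟩ := h.exists_blue_blue hvz 0 0
  obtain ⟨y, hzy, hyw⟩ := h.exists_blue_blue hzw 0 0
  replace hvx : (col v x).IsBlue := ⟨_, hvx⟩
  replace hxz : (col x z).IsBlue := ⟨_, hxz⟩
  replace hzy : (col z y).IsBlue := ⟨_, hzy⟩
  replace hyw : (col y w).IsBlue := ⟨_, hyw⟩
  have hwx : col w x = .red := by
    refine h.eq_red (h.isBlue_comm hvw) hvx ?_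
    rintro rfl
    rw [h.symm, hzw] at hxz
    simp [IsBlue] at hxz
  -- Degrees alone give `50 ≤ 2 |U|`. For strictness, the second blue colour provides another common
  -- neighbour `v'` of `w` and `x`. A point `t` blue to `v'` and red to `v` has no blue edge to `v`,
  -- `w` or `x`, and at most one to the adjacent `y` and `z`.
  obtain ⟨v', hwv', hv'x⟩ := h.exists_blue_blue hwx 1 1
  have hne : v ≠ v' := by
    rintro rfl
    rw [h.symm, hw] at hwv'
    simp at hwv'
  obtain ⟨t, hvt, htv'⟩ := h.exists_red_blue (h.eq_red hvw ⟨_, hwv'⟩ hne) 0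
  have key : ∀ {p q s : U}, (col p q).IsBlue → (col p s).IsBlue → (col q s).IsBlue → False :=
    fun h1 h2 h3 => h.not_isBlue h1 h3 h2
  let g : U → ℕ := fun s => (if (col v s).IsBlue then 1 else 0) + (if (col w s).IsBlue then 1 else 0)
    + (if (col y s).IsBlue then 1 else 0) + (if (col z s).IsBlue then 1 else 0)
    + (if (col x s).IsBlue then 1 else 0)
  have hg : ∀ s, g s ≤ 2 := by
    intro s
    have h1 := key (s := s) hvw
    have h2 := key (s := s) hvx
    have h3 := key (s := s) hxz
    have h4 := key (s := s) hzy
    have h5 := key (s := s) hyw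
    simp only [g]
    split_ifs <;> first | omega | (exfalso; tauto)
  have hgt : g t < 2 := by
    have h1 : ¬ (col v t).IsBlue := by simp [hvt, IsBlue]
    have h2 : ¬ (col w t).IsBlue := fun h' =>
      key h' ⟨_, hwv'⟩ ⟨_, htv'⟩
    have h3 : ¬ (col x t).IsBlue := fun h' =>
      key h' (h.isBlue_comm ⟨_, hv'x⟩) ⟨_, htv'⟩
    have h4 := key (s := t) hzy
    simp only [g, h1, h2, h3, if_false]
    split_ifs <;> first | omega | (exfalso; tauto)
  have hsum : ∑ s, g s < ∑ _s : U, 2 :=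
    Finset.sum_lt_sum (fun s _ => hg s) ⟨t, Finset.mem_univ t, hgt⟩
  have hd : ∀ p, 10 ≤ (Finset.univ.filter fun s => (col p s).IsBlue).card := h.le_card_isBlue
  simp only [g, Finset.sum_add_distrib, ← Finset.card_filter, Finset.sum_const, Finset.card_univ,
    smul_eq_mul] at hsum
  have h1 := hd v
  have h2 := hd w
  have h3 := hd x
  have h4 := hd y
  have h5 := hd z
  omega

end RelationAlgebra

/-! ### Rich colourings by the union bound -/

open scoped symmDiff

/-- For `y` in `F`, let the pairs `{y, σ y}` be disjoint. Of all maps `c` to `n` colours, a proportion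
of at most `(1 - 1 / n²) ^ |F|` has `(c y, c (σ y)) ≠ (i, j)` for all `y ∈ F`. -/
theorem card_forall_pair_ne_le {β : Type*} [Fintype β] [DecidableEq β] {n : ℕ} (σ : β → β)
    (i j : Fin n) (F : Finset β) (hinj : Set.InjOn σ F) (hdisj : ∀ y ∈ F, ∀ y' ∈ F, σ y ≠ y') :
    ((Finset.univ.filter fun c : β → Fin n => ∀ y ∈ F, ¬ (c y = i ∧ c (σ y) = j)).card : ℝ) ≤
      (1 - 1 / (n : ℝ) ^ 2) ^ F.card * (n : ℝ) ^ Fintype.card β := by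
  induction F using Finset.induction_on with
  | empty => simp
  | @insert y F hy ih =>
    have hn : (0 : ℝ) < n := by exact_mod_cast i.pos
    have hn1 : (1 : ℝ) ≤ n := by exact_mod_cast i.pos
    have ih := ih (hinj.mono (by simp)) (fun a ha b hb =>
      hdisj a (Finset.mem_insert_of_mem ha) b (Finset.mem_insert_of_mem hb))
    set S := Finset.univ.filter fun c : β → Fin n => ∀ y ∈ F, ¬ (c y = i ∧ c (σ y) = j) with hS
    have hσy : σ y ≠ y := hdisj y (by simp) y (by simp)
    have hsplit : (Finset.univ.filter fun c : β → Fin n =>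
        ∀ y' ∈ insert y F, ¬ (c y' = i ∧ c (σ y') = j)) =
        S.filter fun c => ¬ (c y = i ∧ c (σ y) = j) := by
      ext c
      simp only [hS, Finset.mem_filter, Finset.mem_univ, true_and, Finset.forall_mem_insert]
      exact and_comm
    -- Overwriting the values at `y` and `σ y` by `i` and `j`, and recording the old ones, is
    -- injective and keeps the constraints on `F`. So at least `1 / n²` of `S` is excluded by the
    -- new pair.
    have hle : S.card ≤ ((S.filter fun c => c y = i ∧ c (σ y) = j) ×ˢ
        (Finset.univ : Finset (Fin n × Fin n))).card := by
      refine Finset.card_le_card_of_injOn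
        (fun c => (Function.update (Function.update c y i) (σ y) j, (c y, c (σ y)))) ?_ ?_
      · intro c hc
        simp only [hS, Finset.coe_filter, Finset.mem_univ, true_and, Set.mem_ofPred_eq] at hc
        simp only [hS, Finset.coe_product, Set.mem_prod, Finset.mem_coe, Finset.mem_filter,
          Finset.mem_univ, true_and, and_true]
        refine ⟨fun a ha => ?_, ?_, ?_⟩
        · have h1 : a ≠ y := fun h => hy (h ▸ ha)
          have h2 : a ≠ σ y := fun h => hdisj y (by simp) a (by simp [ha]) h.symm
          have h3 : σ a ≠ y := hdisj a (by simp [ha]) y (by simp)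
          have h4 : σ a ≠ σ y := fun h => h1 (hinj (by simp [ha]) (by simp) h)
          simpa [Function.update_of_ne, h1, h2, h3, h4] using hc a ha
        · simp [Function.update_of_ne hσy.symm]
        · simp
      · intro c _ c' _ hcc
        simp only [Prod.mk.injEq] at hcc
        obtain ⟨h1, h2, h3⟩ := hcc
        funext a
        by_cases ha : a = σ y
        · rw [ha, h3]
        by_cases ha' : a = y
        · rw [ha', h2]
        simpa [Function.update_of_ne, ha, ha'] using congrFun h1 a
    rw [Finset.card_product, Finset.card_univ, Fintype.card_prod, Fintype.card_fin] at hle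
    have hadd := Finset.card_filter_add_card_filter_not (s := S)
      (fun c => c y = i ∧ c (σ y) = j)
    rw [hsplit, Finset.card_insert_of_notMem hy, pow_succ']
    have h1 : (S.card : ℝ) ≤ (S.filter fun c => c y = i ∧ c (σ y) = j).card * (n : ℝ) ^ 2 := by
      rw [pow_two]; exact_mod_cast hle
    have h2 : ((S.filter fun c => c y = i ∧ c (σ y) = j).card : ℝ) +
        (S.filter fun c => ¬ (c y = i ∧ c (σ y) = j)).card = S.card := by exact_mod_cast hadd
    have h3 : (S.card : ℝ) / (n : ℝ) ^ 2 ≤ (S.filter fun c => c y = i ∧ c (σ y) = j).card :=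
      (div_le_iff₀ (by positivity)).2 h1
    have h4 : (0 : ℝ) ≤ 1 - 1 / (n : ℝ) ^ 2 := by
      rw [sub_nonneg, div_le_one (by positivity)]
      exact one_le_pow₀ hn1
    calc ((S.filter fun c => ¬ (c y = i ∧ c (σ y) = j)).card : ℝ)
        ≤ (1 - 1 / (n : ℝ) ^ 2) * S.card := by
          have : (1 - 1 / (n : ℝ) ^ 2) * S.card = S.card - S.card / (n : ℝ) ^ 2 := by ring
          linarith
      _ ≤ (1 - 1 / (n : ℝ) ^ 2) *
          ((1 - 1 / (n : ℝ) ^ 2) ^ F.card * (n : ℝ) ^ Fintype.card β) :=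
          mul_le_mul_of_nonneg_left ih h4
      _ = _ := by ring

/-- A nonempty set `X` of at most `2k` of `3k + 1` points is the symmetric difference of many pairs of
sets of size at most `k`; the sets in `F` are the members of such pairs that contain `x`. -/
theorem exists_many_symmDiff_eq {α : Type*} [Fintype α] [DecidableEq α] {k : ℕ}
    (hα : Fintype.card α = 3 * k + 1) {X : Finset α} (hX : X.Nonempty) (hXk : X.card ≤ 2 * k) :
    ∃ (F : Finset (Finset α)) (x : α), 4 ^ (k - 1) ≤ k ^ 2 * F.card ∧
      ∀ Y ∈ F, x ∈ Y ∧ x ∉ Y ∆ X ∧ Y.card ≤ k ∧ (Y ∆ X).card ≤ k := by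
  obtain ⟨x, hx⟩ := hX
  have hs : 1 ≤ X.card := Finset.card_pos.2 ⟨x, hx⟩
  -- `Y` consists of `x`, of `a` further points of `X` and of `b` points outside. Then `Y` has `a +
  -- b + 1 = k` points and `Y ∆ X` has `b + |X| - 1 - a ≤ k`.
  obtain ⟨a, ha1, ha2⟩ : ∃ a, 2 * a + 1 ≤ X.card ∧ X.card ≤ 2 * a + 2 :=
    ⟨(X.card - 1) / 2, by omega, by omega⟩
  obtain ⟨b, hb⟩ : ∃ b, k = a + b + 1 := ⟨k - 1 - a, by omega⟩
  let D := Finset.powersetCard a (X.erase x) ×ˢ Finset.powersetCard b Xᶜ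
  let g : Finset α × Finset α → Finset α := fun p => insert x (p.1 ∪ p.2)
  have hD : ∀ p ∈ D, (p.1 ⊆ X.erase x ∧ p.1.card = a) ∧ p.2 ⊆ Xᶜ ∧ p.2.card = b := by
    intro p hp
    simpa [D, Finset.mem_product, Finset.mem_powersetCard] using hp
  have hg : Set.InjOn g D := by
    have hrec : ∀ p ∈ D, (g p ∩ X).erase x = p.1 ∧ g p ∩ Xᶜ = p.2 := by
      intro p hp
      obtain ⟨⟨h1, -⟩, h2, -⟩ := hD p hp
      constructor
      · ext t
        have h3 := @h1 t
        have h4 := @h2 t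
        simp only [Finset.mem_erase, Finset.mem_compl] at h3 h4
        simp only [g, Finset.mem_erase, Finset.mem_inter, Finset.mem_insert, Finset.mem_union]
        tauto
      · ext t
        have h3 := @h1 t
        have h4 := @h2 t
        have h5 : t = x → t ∈ X := fun h => h ▸ hx
        simp only [Finset.mem_erase, Finset.mem_compl] at h3 h4
        simp only [g, Finset.mem_inter, Finset.mem_insert, Finset.mem_union, Finset.mem_compl]
        tauto
    intro p hp q hq hpq
    have h1 := hrec p hp
    have h2 := hrec q hq
    rw [hpq] at h1
    exact Prod.ext (h1.1.symm.trans h2.1) (h1.2.symm.trans h2.2)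
  refine ⟨D.image g, x, ?_, ?_⟩
  · rw [Finset.card_image_of_injOn hg, Finset.card_product, Finset.card_powersetCard,
      Finset.card_powersetCard, Finset.card_erase_of_mem hx, Finset.card_compl, hα]
    have h1 : Nat.centralBinom a ≤ (X.card - 1).choose a := Nat.choose_le_choose a (by omega)
    have h2 : Nat.centralBinom b ≤ (3 * k + 1 - X.card).choose b :=
      Nat.choose_le_choose b (by omega)
    have h3 := Nat.four_pow_le_two_mul_add_one_mul_central_binom a
    have h4 := Nat.four_pow_le_two_mul_add_one_mul_central_binom b
    -- The factors have mean `a + b + 1 = k`.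
    have h5 : (2 * a + 1) * (2 * b + 1) ≤ k ^ 2 := by
      subst hb
      zify
      nlinarith [sq_nonneg ((a : ℤ) - b)]
    calc 4 ^ (k - 1) = 4 ^ a * 4 ^ b := by rw [← pow_add]; congr 1; omega
      _ ≤ ((2 * a + 1) * Nat.centralBinom a) * ((2 * b + 1) * Nat.centralBinom b) :=
        Nat.mul_le_mul h3 h4
      _ = ((2 * a + 1) * (2 * b + 1)) * (Nat.centralBinom a * Nat.centralBinom b) := by ring
      _ ≤ _ := Nat.mul_le_mul h5 (Nat.mul_le_mul h1 h2)
  · intro Y hY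
    obtain ⟨p, hp, rfl⟩ := Finset.mem_image.1 hY
    obtain ⟨⟨h1, h1'⟩, h2, h2'⟩ := hD p hp
    have hsd : g p ∆ X ⊆ p.2 ∪ (X.erase x \ p.1) := by
      intro t
      have h3 := @h1 t
      have h5 : t = x → t ∈ X := fun h => h ▸ hx
      simp only [Finset.mem_erase] at h3
      simp only [g, Finset.mem_symmDiff, Finset.mem_insert, Finset.mem_union, Finset.mem_sdiff,
        Finset.mem_erase]
      tauto
    refine ⟨by simp [g], by simp [g, Finset.mem_symmDiff, hx], ?_, ?_⟩
    · have h3 := Finset.card_insert_le x (p.1 ∪ p.2)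
      have h4 := Finset.card_union_le p.1 p.2
      simp only [g]
      omega
    · have h3 := Finset.card_le_card hsd
      have h4 := Finset.card_union_le p.2 (X.erase x \ p.1)
      rw [Finset.card_sdiff_of_subset h1, Finset.card_erase_of_mem hx] at h4
      omega

/-- Sets of at most `k` of `3k + 1` points can be coloured such that every nonempty set of at most
`2k` points is a symmetric difference of sets of prescribed colours. -/
def IsRichColoring {α : Type*} [DecidableEq α] {n : ℕ} (k : ℕ) (d : Finset α → Fin n) : Prop :=
  ∀ X : Finset α, X.Nonempty → X.card ≤ 2 * k → ∀ i j,
    ∃ Y, Y.card ≤ k ∧ (Y ∆ X).card ≤ k ∧ d Y = i ∧ d (Y ∆ X) = j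

/-- With `n² ≤ 2^(k+1)` this makes the number of available pairs at least `n² (4k + 2)`. The
inequality fails for `k = 17`. -/
theorem two_pow_mul_le_four_pow {k : ℕ} (hk : 18 ≤ k) :
    2 ^ (k + 1) * (k ^ 2 * (4 * k + 2)) ≤ 4 ^ (k - 1) := by
  induction k, hk using Nat.le_induction with
  | base => norm_num
  | succ k hk ih =>
    have h1 : 4 ^ (k + 1 - 1) = 4 * 4 ^ (k - 1) := by
      rw [← pow_succ']; congr 1; omega
    have h2 : (k + 1) ^ 2 * (4 * (k + 1) + 2) ≤ 2 * (k ^ 2 * (4 * k + 2)) := by nlinarith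
    calc 2 ^ (k + 1 + 1) * ((k + 1) ^ 2 * (4 * (k + 1) + 2))
        ≤ 2 ^ (k + 1 + 1) * (2 * (k ^ 2 * (4 * k + 2))) := Nat.mul_le_mul_left _ h2
      _ = 4 * (2 ^ (k + 1) * (k ^ 2 * (4 * k + 2))) := by ring
      _ ≤ _ := by rw [h1]; exact Nat.mul_le_mul_left _ ih

/-- There are at most `2^(3k+1) n² ≤ 2^(4k+2)` requirements `(X, i, j)`, each violated by a
proportion of at most `exp(-(4k+2))` of all colourings; since `2 < e`, some colouring violates none.
-/
theorem exists_isRichColoring {α : Type*} [Fintype α] [DecidableEq α] {n k : ℕ} (hn : 0 < n)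
    (hk : 18 ≤ k) (hnk : n ^ 2 ≤ 2 ^ (k + 1)) (hα : Fintype.card α = 3 * k + 1) :
    ∃ d : Finset α → Fin n, IsRichColoring k d := by
  by_contra hcon
  push Not at hcon
  let bad : Finset α × Fin n × Fin n → Finset (Finset α → Fin n) := fun q =>
    Finset.univ.filter fun d =>
      ∀ Y : Finset α, Y.card ≤ k → (Y ∆ q.1).card ≤ k → ¬ (d Y = q.2.1 ∧ d (Y ∆ q.1) = q.2.2)
  let Q : Finset (Finset α × Fin n × Fin n) :=
    Finset.univ.filter fun q => q.1.Nonempty ∧ q.1.card ≤ 2 * k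
  have hcover : (Finset.univ : Finset (Finset α → Fin n)) ⊆ Q.biUnion bad := by
    intro d _
    have h := hcon d
    unfold IsRichColoring at h
    push Not at h
    obtain ⟨X, h1, h2, i, j, h3⟩ := h
    refine Finset.mem_biUnion.2 ⟨(X, i, j), by simp [Q, h1, h2], ?_⟩
    simp only [bad, Finset.mem_filter, Finset.mem_univ, true_and]
    exact fun Y hY hY' h => h3 Y hY hY' h.1 h.2
  set N : ℝ := (n : ℝ) ^ Fintype.card (Finset α) with hN
  have hn0 : (0 : ℝ) < n := by exact_mod_cast hn
  have hNpos : 0 < N := by positivity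
  have hbad : ∀ q ∈ Q, ((bad q).card : ℝ) ≤ Real.exp (-(4 * k + 2)) * N := by
    rintro ⟨X, i, j⟩ hq
    simp only [Q, Finset.mem_filter, Finset.mem_univ, true_and] at hq
    obtain ⟨F, x, hF, hFY⟩ := exists_many_symmDiff_eq hα hq.1 hq.2
    -- The marked point `x` lies in every `Y ∈ F` and in no `Y ∆ X`, so the pairs are disjoint.
    have h1 := card_forall_pair_ne_le (fun Y : Finset α => Y ∆ X) i j F
      (fun Y _ Z _ h => symmDiff_left_injective X h)
      (fun Y hY Z hZ h => (hFY Y hY).2.1 (h ▸ (hFY Z hZ).1))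
    have h2 : ((bad (X, i, j)).card : ℝ) ≤ (Finset.univ.filter fun c : Finset α → Fin n =>
        ∀ Y ∈ F, ¬ (c Y = i ∧ c (Y ∆ X) = j)).card := by
      refine Nat.cast_le.2 (Finset.card_le_card fun d hd => ?_)
      simp only [bad, Finset.mem_filter, Finset.mem_univ, true_and] at hd ⊢
      exact fun Y hY => hd Y (hFY Y hY).2.2.1 (hFY Y hY).2.2.2
    refine h2.trans (h1.trans (mul_le_mul_of_nonneg_right ?_ hNpos.le))
    have h3 : n ^ 2 * (4 * k + 2) ≤ F.card := by
      have h4 := (two_pow_mul_le_four_pow hk).trans hF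
      have h5 : k ^ 2 * (2 ^ (k + 1) * (4 * k + 2)) ≤ k ^ 2 * F.card := by
        calc _ = _ := by ring
          _ ≤ _ := h4
      exact (Nat.mul_le_mul_right _ hnk).trans (Nat.le_of_mul_le_mul_left h5 (by positivity))
    have h4 : ((n : ℝ) ^ 2 * (4 * k + 2)) ≤ F.card := by exact_mod_cast h3
    have h5 : (1 : ℝ) - 1 / (n : ℝ) ^ 2 ≤ Real.exp (-(1 / (n : ℝ) ^ 2)) := by
      have := Real.add_one_le_exp (-(1 / (n : ℝ) ^ 2))
      linarith
    have h6 : (0 : ℝ) ≤ 1 - 1 / (n : ℝ) ^ 2 := by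
      rw [sub_nonneg, div_le_one (by positivity)]
      exact one_le_pow₀ (by exact_mod_cast hn)
    calc (1 - 1 / (n : ℝ) ^ 2) ^ F.card ≤ Real.exp (-(1 / (n : ℝ) ^ 2)) ^ F.card :=
          pow_le_pow_left₀ h6 h5 _
      _ = Real.exp (F.card * -(1 / (n : ℝ) ^ 2)) := (Real.exp_nat_mul _ _).symm
      _ ≤ _ := by
        rw [Real.exp_le_exp, mul_neg, neg_le_neg_iff, mul_one_div, le_div_iff₀ (by positivity)]
        linarith
  have h1 : N ≤ ∑ q ∈ Q, ((bad q).card : ℝ) := by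
    have h2 := (Finset.card_le_card hcover).trans Finset.card_biUnion_le
    rw [Finset.card_univ, Fintype.card_fun, Fintype.card_fin] at h2
    rw [hN]
    exact_mod_cast h2
  have h2 : (Q.card : ℝ) ≤ 2 ^ (4 * k + 2) := by
    have h3 : Q.card ≤ 2 ^ (3 * k + 1) * (n * n) := by
      refine (Finset.card_le_univ Q).trans ?_
      simp [Fintype.card_prod, Fintype.card_finset, hα]
    have h4 : 2 ^ (3 * k + 1) * (n * n) ≤ 2 ^ (4 * k + 2) := by
      calc 2 ^ (3 * k + 1) * (n * n) ≤ 2 ^ (3 * k + 1) * 2 ^ (k + 1) :=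
            Nat.mul_le_mul_left _ (by rw [← pow_two]; exact hnk)
        _ = _ := by rw [← pow_add]; congr 1; omega
    exact_mod_cast h3.trans h4
  have h3 : N ≤ 2 ^ (4 * k + 2) * (Real.exp (-(4 * k + 2)) * N) := by
    refine h1.trans ((Finset.sum_le_sum hbad).trans ?_)
    rw [Finset.sum_const, nsmul_eq_mul]
    exact mul_le_mul_of_nonneg_right h2 (by positivity)
  have h4 : (2 : ℝ) ^ (4 * k + 2) < Real.exp (4 * k + 2) := by
    have h5 : (2 : ℝ) < Real.exp 1 := by linarith [Real.exp_one_gt_d9]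
    calc (2 : ℝ) ^ (4 * k + 2) < Real.exp 1 ^ (4 * k + 2) :=
          pow_lt_pow_left₀ h5 (by norm_num) (by omega)
      _ = _ := by rw [← Real.exp_nat_mul]; push_cast; rw [mul_one]
  have h5 : (2 : ℝ) ^ (4 * k + 2) * Real.exp (-(4 * k + 2)) < 1 := by
    rw [Real.exp_neg, ← div_eq_mul_inv, div_lt_one (Real.exp_pos _)]
    exact h4
  nlinarith

/-! ### An explicit rich colouring for ten points -/

/-- The colour, `0` or `1`, of the set of numbers below `10` with binary code `m`. -/
def smallSetColor (m : ℕ) : ℕ :=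
  -- The literal is a table of 77 bits, read at `m` modulo `77`; its richness is established by
  -- computation in `isRichAt_of_lt`.
  Nat.land (Nat.shiftRight 101877788075213286851502 (Nat.mod m 77)) 1

/-- The number of binary digits `1` of `m`, for `m < 1024`. -/
def bitCount (m : ℕ) : ℕ :=
  let d := fun i => Nat.land (Nat.shiftRight m i) 1
  Nat.add (d 0) <| Nat.add (d 1) <| Nat.add (d 2) <| Nat.add (d 3) <| Nat.add (d 4) <|
    Nat.add (d 5) <| Nat.add (d 6) <| Nat.add (d 7) <| Nat.add (d 8) (d 9)

/-- `List.any`, by the recursor, which is faster to evaluate in the kernel. -/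
noncomputable def anyOf (p : ℕ → Bool) (l : List ℕ) : Bool :=
  List.rec false (fun a _ ih => p a || ih) l

/-- Some set with at most three elements has colour `i`, and its symmetric difference with the set
coded by `x` has at most three elements and colour `j`. -/
noncomputable def hasSmallPair (i j x : ℕ) : Bool :=
  let p := [1, 2, 4, 8, 16, 32, 64, 128, 256, 512]
  -- Repetitions among `a`, `b`, `c` give the sets with one or two elements; the empty set is not
  -- tried.
  anyOf (fun a => anyOf (fun b => anyOf (fun c =>
    Nat.beq (smallSetColor (Nat.lor b (Nat.lor c a))) i &&
      (Nat.beq (smallSetColor (Nat.xor (Nat.lor b (Nat.lor c a)) x)) j &&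
        Nat.ble (bitCount (Nat.xor (Nat.lor b (Nat.lor c a)) x)) 3)) p) p) p

/-- All pairs of colours occur for the set coded by `x`, if it has between one and six elements. -/
noncomputable def isRichAt (x : ℕ) : Bool :=
  Nat.beq x 0 || (Nat.ble 7 (bitCount x) ||
    -- Colours `1`, `0` follow from `0`, `1` by exchanging the two sets.
    (hasSmallPair 0 0 x && (hasSmallPair 0 1 x && hasSmallPair 1 1 x)))

set_option maxHeartbeats 1000000 in
theorem isRichAt_of_lt : (List.range 1024).all isRichAt = true := by
  decide +kernel

theorem anyOf_eq_true {p : ℕ → Bool} {l : List ℕ} (h : anyOf p l = true) : ∃ a ∈ l, p a = true := by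
  induction l with
  | nil => exact absurd h (by simp [anyOf])
  | cons a l ih =>
    have h' : (p a || anyOf p l) = true := h
    rcases Bool.or_eq_true_iff.1 h' with h' | h'
    · exact ⟨a, by simp, h'⟩
    · obtain ⟨b, hb, hb'⟩ := ih h'
      exact ⟨b, by simp [hb], hb'⟩

theorem bitCount_le_of_mem : ∀ a ∈ [1, 2, 4, 8, 16, 32, 64, 128, 256, 512],
    ∀ b ∈ [1, 2, 4, 8, 16, 32, 64, 128, 256, 512], ∀ c ∈ [1, 2, 4, 8, 16, 32, 64, 128, 256, 512],
      bitCount (Nat.lor b (Nat.lor c a)) ≤ 3 ∧ Nat.lor b (Nat.lor c a) < 1024 := by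
  decide +kernel

theorem exists_of_hasSmallPair {i j x : ℕ} (h : hasSmallPair i j x = true) :
    ∃ y < 1024, bitCount y ≤ 3 ∧ bitCount (y ^^^ x) ≤ 3 ∧ smallSetColor y = i ∧
      smallSetColor (y ^^^ x) = j := by
  unfold hasSmallPair at h
  obtain ⟨a, ha, h⟩ := anyOf_eq_true h
  obtain ⟨b, hb, h⟩ := anyOf_eq_true h
  obtain ⟨c, hc, h⟩ := anyOf_eq_true h
  rw [Bool.and_eq_true_iff, Bool.and_eq_true_iff] at h
  obtain ⟨h1, h2⟩ := bitCount_le_of_mem a ha b hb c hc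
  exact ⟨_, h2, h1, Nat.le_of_ble_eq_true h.2.2, Nat.eq_of_beq_eq_true h.1,
    Nat.eq_of_beq_eq_true h.2.1⟩

/-- The set of numbers below `10` with binary code `m`. -/
def bitSet (m : ℕ) : Finset (Fin 10) := Finset.univ.filter fun i => m.testBit i

/-- The binary code of a set of numbers below `10`. -/
def bitCode (X : Finset (Fin 10)) : ℕ := Nat.ofBits fun i => decide (i ∈ X)

theorem bitCode_lt (X : Finset (Fin 10)) : bitCode X < 1024 := Nat.ofBits_lt_two_pow _

theorem bitSet_bitCode (X : Finset (Fin 10)) : bitSet (bitCode X) = X := by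
  ext i
  simp [bitSet, bitCode, Nat.testBit_ofBits_lt]

theorem bitCode_bitSet {m : ℕ} (hm : m < 1024) : bitCode (bitSet m) = m := by
  refine Nat.eq_of_testBit_eq fun i => ?_
  by_cases hi : i < 10
  · simp [bitSet, bitCode, Nat.testBit_ofBits_lt, hi]
  · rw [bitCode, Nat.testBit_ofBits_ge _ _ (not_lt.1 hi), Nat.testBit_lt_two_pow]
    exact hm.trans_le (Nat.pow_le_pow_right (n := 2) (by norm_num) (not_lt.1 hi))

theorem bitSet_xor (x y : ℕ) : bitSet (x ^^^ y) = bitSet x ∆ bitSet y := by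
  ext i
  simp only [bitSet, Finset.mem_symmDiff, Finset.mem_filter, Finset.mem_univ, true_and,
    Nat.testBit_xor]
  cases x.testBit i <;> cases y.testBit i <;> simp

theorem card_bitSet (m : ℕ) : (bitSet m).card = bitCount m := by
  have h : ∀ i, Nat.land (Nat.shiftRight m i) 1 = if m.testBit i then 1 else 0 := by
    intro i
    have h1 : Nat.land (Nat.shiftRight m i) 1 = (m.testBit i).toNat := by
      rw [Nat.toNat_testBit, ← Nat.shiftRight_eq_div_pow]
      exact Nat.and_one_is_mod _
    rw [h1]
    cases m.testBit i <;> rfl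
  simp only [bitSet, bitCount, Finset.card_filter, Fin.sum_univ_succ, h, Nat.add_eq]
  simp

theorem smallSetColor_lt (m : ℕ) : smallSetColor m < 2 := by
  rw [smallSetColor, show ∀ a, Nat.land a 1 = a % 2 from Nat.and_one_is_mod]
  exact Nat.mod_lt _ (by norm_num)

theorem exists_isRichColoring_two :
    ∃ d : Finset (Fin 10) → Fin 2, IsRichColoring 3 d := by
  refine ⟨fun X => ⟨smallSetColor (bitCode X), smallSetColor_lt _⟩, fun X hX hX6 i j => ?_⟩
  obtain ⟨x, hx, rfl⟩ : ∃ x < 1024, bitSet x = X := ⟨_, bitCode_lt X, bitSet_bitCode X⟩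
  have hrich : isRichAt x = true := List.all_eq_true.1 isRichAt_of_lt x (List.mem_range.2 hx)
  have hx0 : Nat.beq x 0 = false := by
    refine Bool.eq_false_iff.2 fun h => ?_
    rw [Nat.eq_of_beq_eq_true h] at hX
    simp [bitSet] at hX
  have hx7 : Nat.ble 7 (bitCount x) = false := by
    refine Bool.eq_false_iff.2 fun h => ?_
    have := Nat.le_of_ble_eq_true h
    rw [card_bitSet] at hX6
    omega
  rw [isRichAt, hx0, hx7, Bool.false_or, Bool.false_or, Bool.and_eq_true_iff,
    Bool.and_eq_true_iff] at hrich
  obtain ⟨h00, h01, h11⟩ := hrich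
  have main : ∀ a b, hasSmallPair a b x = true → ∃ Y Z : Finset (Fin 10), Y ∆ Z = bitSet x ∧
      Y.card ≤ 3 ∧ Z.card ≤ 3 ∧ smallSetColor (bitCode Y) = a ∧ smallSetColor (bitCode Z) = b := by
    intro a b h
    obtain ⟨y, hy, h1, h2, h3, h4⟩ := exists_of_hasSmallPair h
    have hyx : y ^^^ x < 1024 := Nat.xor_lt_two_pow (n := 10) hy hx
    refine ⟨bitSet y, bitSet (y ^^^ x), ?_, by rwa [card_bitSet], by rwa [card_bitSet],
      by rwa [bitCode_bitSet hy], by rwa [bitCode_bitSet hyx]⟩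
    rw [bitSet_xor, symmDiff_symmDiff_cancel_left]
  have main' : ∃ Y Z : Finset (Fin 10), Y ∆ Z = bitSet x ∧ Y.card ≤ 3 ∧ Z.card ≤ 3 ∧
      smallSetColor (bitCode Y) = i ∧ smallSetColor (bitCode Z) = j := by
    fin_cases i <;> fin_cases j
    · exact main _ _ h00
    · exact main _ _ h01
    · obtain ⟨Y, Z, h1, h2, h3, h4, h5⟩ := main _ _ h01
      exact ⟨Z, Y, by rwa [symmDiff_comm], h3, h2, h5, h4⟩
    · exact main _ _ h11
  obtain ⟨Y, Z, h1, h2, h3, h4, h5⟩ := main'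
  have hZ : Y ∆ bitSet x = Z := by rw [← h1, symmDiff_symmDiff_cancel_left]
  exact ⟨Y, h2, by rwa [hZ], Fin.ext h4, Fin.ext (by rw [hZ]; exact h5)⟩

/-! ### Colourings of the Boolean group of sets -/

namespace RelationAlgebra

open SplitAtom

/-- The colouring is invariant under translation, so each condition on triangles reduces to one on
two group elements and their sum. -/
theorem isSplitColoring_symmDiff {n : ℕ} {α : Type*} [DecidableEq α] {c : Finset α → SplitAtom n}
    (hident : ∀ x, c x = .ident ↔ x = ∅) (hsurj : Function.Surjective c)
    (hcyc : ∀ x y, SplitAtom.Cycle (c x) (c y) (c (x ∆ y)))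
    (hwit : ∀ z a b, SplitAtom.Cycle a b (c z) → ∃ x, c x = a ∧ c (x ∆ z) = b) :
    IsSplitColoring fun u v : Finset α => c (u ∆ v) where
  eq_ident_iff u v := by rw [hident]; exact symmDiff_eq_bot
  symm u v := by rw [symmDiff_comm]
  surj a := by
    obtain ⟨x, rfl⟩ := hsurj a
    exact ⟨x, ∅, by rw [← Finset.bot_eq_empty, symmDiff_bot]⟩
  cycle u v w := by
    have h := hcyc (u ∆ v) (v ∆ w)
    rwa [symmDiff_assoc, symmDiff_symmDiff_cancel_left] at h
  witness u w a b h := by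
    obtain ⟨x, hx, hx'⟩ := hwit _ _ _ h
    refine ⟨u ∆ x, by rwa [symmDiff_symmDiff_cancel_left], ?_⟩
    rwa [symmDiff_comm u x, symmDiff_assoc]

/-- In the group of all sets of `3k + 1` points, let the complements of sets of at most `k` points
be blue, coloured by means of a rich colouring, and the other nonempty sets red. -/
theorem exists_isSplitColoring_of_isRichColoring {α : Type*} [Fintype α] [DecidableEq α] {n k : ℕ}
    (hk : 0 < k) (hα : Fintype.card α = 3 * k + 1) {d : Finset α → Fin n}
    (hd : IsRichColoring k d) :
    ∃ col : Finset α → Finset α → SplitAtom n, IsSplitColoring col := by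
  classical
  let B : Finset α → Prop := fun x => 2 * k + 1 ≤ x.card
  have hcompl : ∀ Y : Finset α, Yᶜ.card = 3 * k + 1 - Y.card := fun Y => by
    rw [Finset.card_compl, hα]
  have hBne : ∀ x, B x → x ≠ ∅ := by
    rintro x hx rfl
    simp [B] at hx
  have hsum : ∀ x y, B x → B y → ¬ B (x ∆ y) := by
    intro x y hx hy hxy
    have h1 : x ∆ y ⊆ xᶜ ∪ yᶜ := by
      intro t
      simp only [Finset.mem_symmDiff, Finset.mem_union, Finset.mem_compl]
      tauto
    have h2 := (Finset.card_le_card h1).trans (Finset.card_union_le _ _)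
    rw [hcompl, hcompl] at h2
    simp only [B] at hx hy hxy
    omega
  let c : Finset α → SplitAtom n := fun x =>
    if x = ∅ then .ident else if B x then .blue (d xᶜ) else .red
  have cident : ∀ x, c x = .ident ↔ x = ∅ := by
    intro x
    simp only [c]
    split_ifs <;> simp_all
  have cblue : ∀ x, B x → c x = .blue (d xᶜ) := fun x hx => by simp [c, hBne x hx, hx]
  have cred : ∀ x, x ≠ ∅ → ¬ B x → c x = .red := fun x h1 h2 => by simp [c, h1, h2]
  have cblueB : ∀ x i, c x = .blue i → B x := by
    intro x i h
    by_contra hB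
    simp only [c] at h
    split_ifs at h
  have credB : ∀ x, c x = .red → x ≠ ∅ ∧ ¬ B x := by
    intro x h
    simp only [c] at h
    split_ifs at h with h1 h2
    exact ⟨h1, h2⟩
  have credsum : ∀ x y, B x → B y → x ≠ y → c (x ∆ y) = .red := fun x y hx hy hxy =>
    cred _ (fun h => hxy (symmDiff_eq_bot.1 h)) (hsum x y hx hy)
  -- witnesses with two blue atoms
  have hbb : ∀ z, z ≠ ∅ → ¬ B z → ∀ i j, ∃ x, c x = .blue i ∧ c (x ∆ z) = .blue j := by
    intro z hz hzB i j
    obtain ⟨Y, h1, h2, rfl, rfl⟩ := hd z (Finset.nonempty_iff_ne_empty.2 hz)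
      (by simp only [B] at hzB; omega) i j
    have h3 : Yᶜ ∆ z = (Y ∆ z)ᶜ := by
      ext t
      simp only [Finset.mem_symmDiff, Finset.mem_compl]
      tauto
    refine ⟨Yᶜ, ?_, ?_⟩
    · rw [cblue _ (by simp only [B, hcompl]; omega), compl_compl]
    · rw [h3, cblue _ (by simp only [B, hcompl]; omega), compl_compl]
  obtain ⟨p, -⟩ : (Finset.univ : Finset α).Nonempty := by
    rw [← Finset.card_pos, Finset.card_univ, hα]
    omega
  have hp : c {p} = .red := cred _ (by simp) (by simp [B]; omega)
  have hsub : ∀ z w : Finset α, w ⊆ z → (w ∆ z).card = z.card - w.card := by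
    intro z w h
    rw [symmDiff_of_le h, Finset.card_sdiff_of_subset h]
  -- witnesses with two red atoms
  have hrr : ∀ z, z ≠ ∅ → ∃ x, c x = .red ∧ c (x ∆ z) = .red := by
    intro z hz
    have hz1 : 1 ≤ z.card := Finset.card_pos.2 (Finset.nonempty_iff_ne_empty.2 hz)
    have hz2 : z.card ≤ 3 * k + 1 := hα ▸ Finset.card_le_univ z
    rcases Nat.lt_or_ge 1 z.card with h | h
    · obtain ⟨w, hwz, hw⟩ := Finset.exists_subset_card_eq (Nat.div_le_self z.card 2)
      have h1 := hsub z w hwz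
      refine ⟨w, cred _ ?_ ?_, cred _ ?_ ?_⟩
      · rintro rfl
        simp at hw
        omega
      · simp only [B]; omega
      · intro h'
        rw [h', Finset.card_empty] at h1
        omega
      · simp only [B]; omega
    · obtain ⟨q, hq⟩ : ∃ q, q ∉ z := by
        by_contra hcon
        push Not at hcon
        have := Finset.card_univ (α := α) ▸ Finset.card_le_card (fun t _ => hcon t :
          (Finset.univ : Finset α) ⊆ z)
        omega
      refine ⟨{q}, cred _ (by simp) (by simp [B]; omega), cred _ ?_ ?_⟩
      · intro h'
        exact hq ((symmDiff_eq_bot.1 h') ▸ Finset.mem_singleton_self q)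
      · have h1 : ({q} ∆ z).card ≤ ({q} ∪ z).card := Finset.card_le_card symmDiff_le_sup
        have h2 := Finset.card_union_le {q} z
        rw [Finset.card_singleton] at h2
        simp only [B]
        omega
  -- witnesses with one blue and one red atom
  have hbr : ∀ z, z ≠ ∅ → ∀ i, ∃ x, c x = .blue i ∧ c (x ∆ z) = .red := by
    intro z hz i
    by_cases hzB : B z
    -- Two distinct elements of colour `i` are needed, as one of them may be `z`; any other has a
    -- red sum with the blue `z`.
    · obtain ⟨x, hx, hx'⟩ := hbb {p} (by simp) (credB _ hp).2 i i
      by_cases hxz : x = z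
      · refine ⟨x ∆ {p}, hx', credsum _ _ (cblueB _ _ hx') hzB ?_⟩
        intro h
        rw [hxz, symmDiff_eq_left] at h
        simp at h
      · exact ⟨x, hx, credsum _ _ (cblueB _ _ hx) hzB hxz⟩
    · have hz2 : z.card ≤ 2 * k + 1 := by simp only [B] at hzB; omega
      -- Enlarge `z` to a blue `w`. Writing the small set `z ∆ w` as a sum of two blue elements
      -- makes `x ∆ z` a sum of two blue elements, hence red.
      obtain ⟨w, hwz, hw⟩ := Finset.exists_superset_card_eq hz2 (by omega)
      have hwB : B w := by simp only [B]; omega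
      have hz1 : 1 ≤ z.card := Finset.card_pos.2 (Finset.nonempty_iff_ne_empty.2 hz)
      have h1 := hsub w z hwz
      have hne : z ∆ w ≠ ∅ := fun h => hzB ((symmDiff_eq_bot.1 h) ▸ hwB)
      obtain ⟨x, hx, hx'⟩ := hbb (z ∆ w) hne (by simp only [B]; omega) i i
      refine ⟨x, hx, ?_⟩
      have h2 : x ∆ z = (x ∆ (z ∆ w)) ∆ w := by
        rw [symmDiff_assoc, symmDiff_symmDiff_cancel_right]
      rw [h2]
      refine credsum _ _ (cblueB _ _ hx') hwB ?_
      intro h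
      rw [← symmDiff_eq_bot, ← h2] at h
      exact hzB ((symmDiff_eq_bot.1 h) ▸ cblueB _ _ hx)
  have hsurj : Function.Surjective c := by
    rintro (_ | _ | i)
    · exact ⟨∅, (cident _).2 rfl⟩
    · exact ⟨{p}, hp⟩
    · obtain ⟨x, hx, -⟩ := hbr {p} (by simp) i
      exact ⟨x, hx⟩
  refine ⟨_, isSplitColoring_symmDiff cident hsurj ?_ ?_⟩
  · intro x y
    rcases hx : c x with _ | _ | i
    · rw [(cident _).1 hx, ← Finset.bot_eq_empty, bot_symmDiff]
      cases c y <;> simp [SplitAtom.Cycle]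
    · rcases hy : c y with _ | _ | j
      · rw [(cident _).1 hy, ← Finset.bot_eq_empty, symmDiff_bot, hx]
        simp [SplitAtom.Cycle]
      all_goals rcases hxy : c (x ∆ y) with _ | _ | l
      all_goals simp only [SplitAtom.Cycle, true_or]
      rw [symmDiff_eq_bot.1 ((cident _).1 hxy), hy] at hx
      simp at hx
    · rcases hy : c y with _ | _ | j
      · rw [(cident _).1 hy, ← Finset.bot_eq_empty, symmDiff_bot, hx]
        simp [SplitAtom.Cycle]
      · rcases hxy : c (x ∆ y) with _ | _ | l
        · rw [symmDiff_eq_bot.1 ((cident _).1 hxy), hy] at hx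
          simp at hx
        all_goals simp [SplitAtom.Cycle]
      · by_cases hxy : x = y
        · subst hxy
          rw [symmDiff_self, Finset.bot_eq_empty, (cident _).2 rfl]
          simpa [SplitAtom.Cycle] using hx.symm.trans hy
        · rw [credsum _ _ (cblueB _ _ hx) (cblueB _ _ hy) hxy]
          simp [SplitAtom.Cycle]
  · intro z a b hab
    by_cases hz : z = ∅
    · subst hz
      rw [(cident _).2 rfl] at hab
      obtain ⟨x, rfl⟩ := hsurj a
      refine ⟨x, rfl, ?_⟩
      rw [← Finset.bot_eq_empty, symmDiff_bot]
      generalize c x = a at hab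
      cases a <;> cases b <;> simp_all [SplitAtom.Cycle]
    rcases a with _ | _ | i
    · exact ⟨∅, (cident _).2 rfl, by rw [← Finset.bot_eq_empty, bot_symmDiff]; exact hab.symm⟩
    · rcases b with _ | _ | j
      · exact ⟨z, hab.symm, by rw [symmDiff_self]; exact (cident _).2 rfl⟩
      · exact hrr z hz
      · obtain ⟨x, h1, h2⟩ := hbr z hz j
        exact ⟨x ∆ z, h2, by rwa [symmDiff_symmDiff_cancel_right]⟩
    · rcases b with _ | _ | j
      · exact ⟨z, hab.symm, by rw [symmDiff_self]; exact (cident _).2 rfl⟩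
      · exact hbr z hz i
      · refine hbb z hz (fun hzB => ?_) i j
        rw [cblue z hzB] at hab
        simp [SplitAtom.Cycle] at hab

/-! ### Spectra and the bounds on `f` -/

theorem IsSplitColoring.mem_spec {n : ℕ} {U : Type} [Countable U] {col : U → U → SplitAtom n}
    (h : IsSplitColoring col) : Cardinal.mk U ∈ spec (SplitAlgebra n) :=
  ⟨Cardinal.mk_le_aleph0, U, rfl, h.nonempty_representation⟩

theorem two_pow_mem_spec {n k : ℕ} (hk : 0 < k) {d : Finset (Fin (3 * k + 1)) → Fin n}
    (hd : IsRichColoring k d) :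
    ((2 ^ (3 * k + 1) : ℕ) : Cardinal) ∈ spec (SplitAlgebra n) := by
  obtain ⟨col, hcol⟩ := exists_isSplitColoring_of_isRichColoring hk (Fintype.card_fin _) hd
  have h := hcol.mem_spec
  rwa [Cardinal.mk_fintype, Fintype.card_finset, Fintype.card_fin] at h

/-- Without blue colours there is no rich colouring; the group of order four with all nonzero
elements red serves instead. -/
theorem spec_zero_nonempty : (spec (SplitAlgebra 0)).Nonempty := by
  let c : Finset (Fin 2) → SplitAtom 0 := fun x => if x = ∅ then .ident else .red
  have h : IsSplitColoring fun u v : Finset (Fin 2) => c (u ∆ v) := by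
    refine isSplitColoring_symmDiff (fun x => by simp [c]) ?_ ?_ ?_
    · rintro (_ | _ | i)
      · exact ⟨∅, by simp [c]⟩
      · exact ⟨{0}, by simp [c]⟩
      · exact i.elim0
    · intro x y
      by_cases hx : x = ∅
      · subst hx
        rw [← Finset.bot_eq_empty, bot_symmDiff]
        exact rfl
      by_cases hy : y = ∅
      · subst hy
        rw [← Finset.bot_eq_empty, symmDiff_bot]
        simp only [c, hx, if_false]
        exact rfl
      by_cases hxy : x ∆ y = ∅ <;> simp [c, hx, hy, hxy, SplitAtom.Cycle]
    · intro z a b hab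
      have hdec : ∀ z : Finset (Fin 2), z ≠ ∅ → ∃ x, x ≠ ∅ ∧ x ∆ z ≠ ∅ := by decide
      rcases a with _ | _ | i
      · exact ⟨∅, by simp [c], by rw [← Finset.bot_eq_empty, bot_symmDiff]; exact hab.symm⟩
      · rcases b with _ | _ | j
        · exact ⟨z, hab.symm, by simp [c]⟩
        · by_cases hz : z = ∅
          · exact ⟨{0}, by simp [c], by simp [c, hz]⟩
          · obtain ⟨x, h1, h2⟩ := hdec z hz
            exact ⟨x, by simp [c, h1], by simp only [c, h2, if_false]⟩
        · exact j.elim0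
      · exact i.elim0
  exact ⟨_, h.mem_spec⟩

theorem spec_nonempty (n : ℕ) : (spec (SplitAlgebra n)).Nonempty := by
  rcases Nat.eq_zero_or_pos n with rfl | hn
  · exact spec_zero_nonempty
  · have h : n ^ 2 ≤ 2 ^ (n ^ 2 + 18 + 1) :=
      Nat.lt_two_pow_self.le.trans (Nat.pow_le_pow_right (by norm_num) (by omega))
    obtain ⟨d, hd⟩ := exists_isRichColoring (α := Fin (3 * (n ^ 2 + 18) + 1)) hn (by omega) h
      (Fintype.card_fin _)
    exact ⟨_, two_pow_mem_spec (by omega) hd⟩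

/-- Nonemptiness of the spectrum is essential: it makes the infimum attained, rather than the
default `0`. -/
theorem le_f {n N : ℕ} (h : ∀ (U : Type) [Fintype U] (col : U → U → SplitAtom n),
    IsSplitColoring col → N ≤ Fintype.card U) : (N : Cardinal) ≤ f n := by
  obtain ⟨-, U, hU, ⟨ρ⟩⟩ := csInf_mem (spec_nonempty n)
  change Cardinal.mk U = f n at hU
  rw [← hU]
  obtain ⟨col, hcol⟩ := ρ.exists_isSplitColoring
  rcases finite_or_infinite U with hfin | hinf
  · have := Fintype.ofFinite U
    rw [Cardinal.mk_fintype]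
    exact_mod_cast h U col hcol
  · exact (Cardinal.natCast_le_aleph0).trans (Cardinal.aleph0_le_mk U)

theorem f_le_of_mem_spec {n : ℕ} {a : Cardinal} (h : a ∈ spec (SplitAlgebra n)) : f n ≤ a :=
  csInf_le' h

theorem exists_f_eq_le {n : ℕ} (hn : 2 ^ 9 ≤ n) : ∃ m : ℕ, f n = m ∧ m ≤ 2 * n ^ 6 := by
  have hn2 : n ^ 2 ≠ 0 := by positivity
  -- For `k = ⌊log₂ n²⌋`, `n² < 2^(k+1)` permits the rich colouring, while `2^k ≤ n²` bounds the
  -- group order.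
  have hk : 18 ≤ Nat.log 2 (n ^ 2) := by
    refine Nat.le_log_of_pow_le (by norm_num) ?_
    calc 2 ^ 18 = (2 ^ 9) ^ 2 := by norm_num
      _ ≤ n ^ 2 := Nat.pow_le_pow_left hn 2
  have h1 : 2 ^ Nat.log 2 (n ^ 2) ≤ n ^ 2 := Nat.pow_log_le_self 2 hn2
  obtain ⟨d, hd⟩ := exists_isRichColoring (α := Fin (3 * Nat.log 2 (n ^ 2) + 1))
    (by omega : 0 < n) hk (Nat.lt_pow_succ_log_self (by norm_num) _).le (Fintype.card_fin _)
  have hle := f_le_of_mem_spec (two_pow_mem_spec (by omega) hd)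
  obtain ⟨m, hm⟩ := Cardinal.lt_aleph0.1 (hle.trans_lt Cardinal.natCast_lt_aleph0)
  refine ⟨m, hm, ?_⟩
  rw [hm] at hle
  calc m ≤ 2 ^ (3 * Nat.log 2 (n ^ 2) + 1) := by exact_mod_cast hle
    _ = 2 * (2 ^ Nat.log 2 (n ^ 2)) ^ 3 := by rw [pow_succ, ← pow_mul]; ring
    _ ≤ 2 * (n ^ 2) ^ 3 := Nat.mul_le_mul_left _ (Nat.pow_le_pow_left h1 3)
    _ = 2 * n ^ 6 := by rw [← pow_mul]

end RelationAlgebra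

theorem mainTheorem5 :
    (26 ≤ RelationAlgebra.f 2 ∧ RelationAlgebra.f 2 ≤ 1024) ∧
    (∀ n : ℕ, ((2 * n ^ 2 + 4 * n + 1 : ℕ) : Cardinal) ≤ RelationAlgebra.f n) ∧
    (∃ ε : ℕ → ℝ, Filter.Tendsto ε Filter.atTop (nhds 0) ∧
      ∀ᶠ n : ℕ in Filter.atTop, ∃ m : ℕ, RelationAlgebra.f n = (m : Cardinal) ∧
        (m : ℝ) ≤ 2 * (n : ℝ) ^ (6 + ε n)) := by
  refine ⟨⟨?_, ?_⟩, ?_, fun _ => 0, tendsto_const_nhds, ?_⟩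
  · exact_mod_cast RelationAlgebra.le_f (n := 2) (N := 26) fun U _ col h => h.twentySix_le_card
  · obtain ⟨d, hd⟩ := exists_isRichColoring_two
    have h := RelationAlgebra.f_le_of_mem_spec (RelationAlgebra.two_pow_mem_spec (by norm_num) hd)
    norm_num at h
    exact_mod_cast h
  · intro n
    refine RelationAlgebra.le_f fun U _ col h => ?_
    rcases Nat.eq_zero_or_pos n with rfl | hn
    · obtain ⟨v, -, -⟩ := h.surj .ident
      exact Fintype.card_pos_iff.2 ⟨v⟩
    · have := h.le_card hn
      -- `4n² + 2n + 1` is at least the required bound because `n ≥ 1`.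
      nlinarith
  · filter_upwards [Filter.eventually_ge_atTop (2 ^ 9)] with n hn
    obtain ⟨m, hm, hle⟩ := RelationAlgebra.exists_f_eq_le hn
    refine ⟨m, hm, ?_⟩
    rw [add_zero, show (6 : ℝ) = ((6 : ℕ) : ℝ) by norm_num, Real.rpow_natCast]
    exact_mod_cast hle
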